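/- A \emph{left order} on a group $G$ is a total order $\preceq$ on $G$ such that $f\preceq k$ implies $gf\preceq gk$ for all $f,g,k\in G$; the group $G$ is \emph{left orderable} if it admits a left order. The set $\mathcal{LO}(G)$ of all left orders on $G$ is endowed with the topology generated by the sets $\{\preceq\ \in\mathcal{LO}(G) : \mathrm{id}\prec g\}$, $g\in G$. \textbf{Theorem.} Let $G$ be a countable left orderable group that admits a decomposition $G\cong H*_{h=[a,b]}\mathbb{F}_2(a,b)$, where $H$ is a group, $h\in H$ with $h\neq \mathrm{id}$, $\mathbb{F}_2(a,b)$ is the free group with free basis $a,b$, and $H*_{h=[a,b]}\mathbb{F}_2(a,b)$ is the amalgamated free product of $H$ and $\mathbb{F}_2(a,b)$ in which $h$ is identified with the commutator $[a,b]$. Then the space $\mathcal{LO}(G)$ has no isolated points. -/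

import Mathlib

open scoped commutatorElement

universe u v

/-- A left order on a group `G`: a total order relation `le` on `G` that is invariant under
multiplication on the left. -/
@[ext]
structure LeftOrder (G : Type v) [Group G] where
  /-- the order relation -/
  le : G → G → Prop
  le_refl : ∀ f : G, le f f
  le_trans : ∀ f g k : G, le f g → le g k → le f k
  le_antisymm : ∀ f g : G, le f g → le g f → f = g
  le_total : ∀ f g : G, le f g ∨ le g f
  mul_le_mul_left : ∀ f k : G, le f k → ∀ g : G, le (g * f) (g * k)

namespace LeftOrder

variable {G : Type v} [Group G]

/-- The strict order attached to a left order. -/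
def lt (o : LeftOrder G) (f g : G) : Prop := o.le f g ∧ f ≠ g

/-- The topology of the space of left orders of `G`, generated by the sets
`{o | 1 is smaller than g in o}`, where `g` runs over `G`. Thus a local base at a left order `o`
consists of the finite intersections of those generating sets whose `g` is positive in `o`. -/
instance instTopologicalSpace : TopologicalSpace (LeftOrder G) :=
  TopologicalSpace.generateFrom {U | ∃ g : G, U = {o : LeftOrder G | o.lt 1 g}}

end LeftOrder

/-- A group is left orderable if it admits a left order. -/
def IsLeftOrderable (G : Type v) [Group G] : Prop := Nonempty (LeftOrder G)

/-- The free group of rank two (in an arbitrary universe). -/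
abbrev FreeTwo : Type u := FreeGroup (ULift.{u} (Fin 2))

/-- The first element of the free basis of the free group of rank two. -/
def FreeTwo.a : FreeTwo.{u} := FreeGroup.of ⟨0⟩

/-- The second element of the free basis of the free group of rank two. -/
def FreeTwo.b : FreeTwo.{u} := FreeGroup.of ⟨1⟩

/-- The two factors, `H` and the free group on `a, b`. -/
def HandleFactor (H : Type u) : Bool → Type u
  | true => H
  | false => FreeTwo.{u}

instance HandleFactor.instGroup (H : Type u) [Group H] : ∀ i, Group (HandleFactor H i)
  | true => inferInstanceAs (Group H)
  | false => inferInstanceAs (Group FreeTwo.{u})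

/-- The two homomorphisms from the infinite cyclic group: its generator goes to `h` in `H`, and to
the commutator `[a, b]` in the free group on `a, b`. -/
def handleMap (H : Type u) [Group H] (h : H) : ∀ i, Multiplicative ℤ →* HandleFactor H i
  | true => zpowersHom H h
  | false => zpowersHom FreeTwo.{u} ⁅FreeTwo.a.{u}, FreeTwo.b.{u}⁆

/-- The group `H *_{h = [a, b]} F_2(a, b)`: the pushout of `H` and of the free group on `a, b` that
identifies `h` with `[a, b]`. For `h` of infinite order this is the amalgamated free product over
the infinite cyclic subgroups generated by `h` and by `[a, b]`. -/
abbrev HandleAmalgam (H : Type u) [Group H] (h : H) : Type u :=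
  Monoid.PushoutI (handleMap H h)

/-! An isolated left order is determined by finitely many inequalities. Realize it as the order on
the orbit of a point `x₀` under an action `ρ` on the line. Every action that moves `x₀` in the same
way under a certain finite set then induces the same order (`LeftOrder.IsRealization.isRigid`). The
handle leaves too much freedom for that. Keep the action of `H`, and change the images `A`, `B` of
`a`, `b` only above a large bound, preserving `A B = C B A` with `C = ρ (ι h)`. This is again an
action, and it does not affect finitely many prescribed values (`IsHandle.exists_bound_of_finite`).
The relation says that `B` conjugates `A` to `C⁻¹ A`. So once `A` is altered suitably, `B` can be
rebuilt by transport along iterates (`exists_conj_extension`).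

Two changes suffice. If `A` has arbitrarily large fixed points but moves a far interval `[m, B m]`
up, it can be made to move everything above `m` up (`exists_perturbation_up`). Powers of `a` then
overtake orbit points they could not reach before. Hence `A` has a fixed point between `z` and `B z`
for all large `z`. If `A` and `B` both move all large points up and `C` moves arbitrarily large
points down, `A` can be given a large fixed point (`exists_perturbation_fixed`), which stops powers
of `a` that used to be unbounded. Both contradict rigidity.

The changes of handle `swap`, `flip` and `mul_left` reduce every behaviour at infinity to these
cases, except that of arbitrarily large fixed points for both `A` and `B`. There the fixed points
between `z` and its images force `A` to fix an orbit point, against freeness of the orbit. -/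

/-! ### Handle decompositions -/

/-- The homomorphism `ι : H →* G` and the elements `a`, `b` exhibit `G` as obtained from `H` by
adjoining `a` and `b` with the relation `ι h = [a, b]`; the universal property is required only
for actions on the real line. -/
structure IsHandle {G : Type v} [Group G] {H : Type u} [Group H] (ι : H →* G) (h : H)
    (a b : G) : Prop where
  closure_eq_top : Subgroup.closure (Set.range ι ∪ {a, b}) = ⊤
  rel : a * b = ι h * b * a
  exists_hom : ∀ (ψ : H →* (ℝ ≃o ℝ)) (A B : ℝ ≃o ℝ), A * B = ψ h * B * A →
    ∃ ρ : G →* (ℝ ≃o ℝ), (∀ x, ρ (ι x) = ψ x) ∧ ρ a = A ∧ ρ b = B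

namespace IsHandle

variable {G : Type v} [Group G] {H : Type u} [Group H] {ι : H →* G} {h : H} {a b : G}

theorem closure_eq_top_of_mem (hab : IsHandle ι h a b) {S : Set G}
    (hι : Set.range ι ⊆ S) (ha : a ∈ Subgroup.closure S) (hb : b ∈ Subgroup.closure S) :
    Subgroup.closure S = ⊤ := by
  rw [eq_top_iff, ← hab.closure_eq_top, Subgroup.closure_le]
  rintro x (hx | rfl | rfl)
  · exact Subgroup.subset_closure (hι hx)
  · exact ha
  · exact hb

theorem swap (hab : IsHandle ι h a b) : IsHandle ι h⁻¹ b a where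
  closure_eq_top := by rw [Set.pair_comm]; exact hab.closure_eq_top
  rel := by rw [map_inv, mul_assoc, hab.rel]; group
  exists_hom ψ A B hAB := by
    obtain ⟨ρ, h1, h2, h3⟩ := hab.exists_hom ψ B A (by
      rw [mul_assoc, hAB, map_inv]; group)
    exact ⟨ρ, h1, h3, h2⟩

/-- Here `[a⁻¹, a b a⁻¹] = [a, b]⁻¹`. This reverses the direction of `a` at infinity while `b` is
only conjugated, so keeps its own. -/
theorem flip (hab : IsHandle ι h a b) : IsHandle ι h⁻¹ a⁻¹ (a * b * a⁻¹) where
  closure_eq_top := by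
    have ha : a ∈ Subgroup.closure (Set.range ι ∪ {a⁻¹, a * b * a⁻¹}) := by
      rw [← inv_mem_iff]
      exact Subgroup.subset_closure (by simp)
    refine hab.closure_eq_top_of_mem Set.subset_union_left ha ?_
    have hb : a * b * a⁻¹ ∈ Subgroup.closure (Set.range ι ∪ {a⁻¹, a * b * a⁻¹}) :=
      Subgroup.subset_closure (by simp)
    have := mul_mem (mul_mem (inv_mem ha) hb) ha
    simpa [mul_assoc] using this
  rel := by
    have hr : (ι h)⁻¹ * (a * b) = b * a := by rw [hab.rel]; group
    calc a⁻¹ * (a * b * a⁻¹) = b * a * a⁻¹ * a⁻¹ := by group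
      _ = ι h⁻¹ * (a * b * a⁻¹) * a⁻¹ := by rw [← hr, map_inv]; group
  exists_hom ψ A B hAB := by
    obtain ⟨ρ, h1, h2, h3⟩ := hab.exists_hom ψ A⁻¹ (A * B * A⁻¹) (by
      have hr : ψ h * (A * B) = B * A := by rw [hAB, map_inv]; group
      calc A⁻¹ * (A * B * A⁻¹) = B * A * A⁻¹ * A⁻¹ := by group
        _ = ψ h * (A * B * A⁻¹) * A⁻¹ := by rw [← hr]; group)
    exact ⟨ρ, h1, by simp [h2], by rw [map_mul, map_mul, map_inv, h2, h3]; group⟩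

theorem mul_left (hab : IsHandle ι h a b) : IsHandle ι h (a * b) b where
  closure_eq_top := by
    have hb : b ∈ Subgroup.closure (Set.range ι ∪ {a * b, b}) :=
      Subgroup.subset_closure (by simp)
    have ha : a * b ∈ Subgroup.closure (Set.range ι ∪ {a * b, b}) :=
      Subgroup.subset_closure (by simp)
    refine hab.closure_eq_top_of_mem Set.subset_union_left ?_ hb
    simpa using mul_mem ha (inv_mem hb)
  rel := by rw [hab.rel]; group; rw [mul_assoc, hab.rel]; group
  exists_hom ψ A B hAB := by
    obtain ⟨ρ, h1, h2, h3⟩ := hab.exists_hom ψ (A * B⁻¹) B (by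
      have : A = ψ h * B * A * B⁻¹ := by rw [← hAB]; group
      calc A * B⁻¹ * B = A := by group
        _ = ψ h * B * (A * B⁻¹) := by rw [← mul_assoc]; exact this)
    exact ⟨ρ, h1, by rw [map_mul, h2, h3]; group, h3⟩

end IsHandle

/-! ### The amalgam has a handle, and `h` survives in it -/

namespace HandleAmalgam

variable (H : Type u) [Group H] (h : H)

/-- The canonical homomorphism from `H`. -/
def ofBase : H →* HandleAmalgam H h :=
  Monoid.PushoutI.of (φ := handleMap H h) true

/-- The canonical homomorphism from the free group. -/
def ofFree : FreeTwo.{u} →* HandleAmalgam H h :=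
  Monoid.PushoutI.of (φ := handleMap H h) false

theorem ofBase_eq : ofBase H h h = ofFree H h ⁅FreeTwo.a, FreeTwo.b⁆ := by
  have h1 := Monoid.PushoutI.of_apply_eq_base (handleMap H h) true (Multiplicative.ofAdd 1)
  have h2 := Monoid.PushoutI.of_apply_eq_base (handleMap H h) false (Multiplicative.ofAdd 1)
  have h3 := h1.trans h2.symm
  have e1 : handleMap H h true (Multiplicative.ofAdd 1) = h := by
    change zpowersHom H h (Multiplicative.ofAdd 1) = h
    simp
  have e2 : handleMap H h false (Multiplicative.ofAdd 1) =
      (⁅FreeTwo.a, FreeTwo.b⁆ : FreeTwo.{u}) := by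
    change zpowersHom FreeTwo.{u} ⁅FreeTwo.a.{u}, FreeTwo.b.{u}⁆ (Multiplicative.ofAdd 1) = _
    simp
  rw [e1, e2] at h3
  exact h3

variable {H h}

/-- The target is arbitrary because two are needed: automorphisms of the line for `IsHandle`, and
permutations to detect `h`. -/
theorem exists_hom {K : Type*} [Group K] (ψ : H →* K) (A B : K) (hAB : ψ h = ⁅A, B⁆) :
    ∃ ρ : HandleAmalgam H h →* K, (∀ x, ρ (ofBase H h x) = ψ x) ∧
      ρ (ofFree H h FreeTwo.a) = A ∧ ρ (ofFree H h FreeTwo.b) = B := by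
  let f : FreeTwo.{u} →* K := FreeGroup.lift fun i => if i.down = 0 then A else B
  have fa : f FreeTwo.a = A := by simp [f, FreeTwo.a]
  have fb : f FreeTwo.b = B := by simp [f, FreeTwo.b]
  let F : ∀ i, HandleFactor H i →* K := fun i => match i with
    | true => ψ
    | false => f
  let ρ : HandleAmalgam H h →* K := Monoid.PushoutI.lift F (zpowersHom K (ψ h)) (by
    rintro (_ | _)
    · refine MonoidHom.ext_mint ?_
      change f (zpowersHom FreeTwo.{u} ⁅FreeTwo.a.{u}, FreeTwo.b.{u}⁆ (Multiplicative.ofAdd 1)) = _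
      simp [map_commutatorElement, fa, fb, hAB]
    · refine MonoidHom.ext_mint ?_
      change ψ (zpowersHom H h (Multiplicative.ofAdd 1)) = _
      simp)
  have h1 : ∀ x, ρ (ofBase H h x) = ψ x := fun x =>
    Monoid.PushoutI.lift_of (i := true) (φ := handleMap H h) F _ _ x
  have h2 : ∀ x, ρ (ofFree H h x) = f x := fun x =>
    Monoid.PushoutI.lift_of (i := false) (φ := handleMap H h) F _ _ x
  exact ⟨ρ, h1, by rw [h2, fa], by rw [h2, fb]⟩

theorem closure_eq_top : Subgroup.closure (Set.range (ofBase H h) ∪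
    {ofFree H h FreeTwo.a, ofFree H h FreeTwo.b}) = ⊤ := by
  set S := Subgroup.closure (Set.range (ofBase H h) ∪
    {ofFree H h FreeTwo.a, ofFree H h FreeTwo.b})
  have hH : ∀ x, ofBase H h x ∈ S := fun x => Subgroup.subset_closure (Or.inl ⟨x, rfl⟩)
  have hF : ∀ x, ofFree H h x ∈ S := by
    intro x
    induction x using FreeGroup.induction_on with
    | C1 => simp
    | of i =>
      obtain ⟨i⟩ := i
      fin_cases i
      · exact Subgroup.subset_closure (Or.inr (Or.inl rfl))
      · exact Subgroup.subset_closure (Or.inr (Or.inr rfl))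
    | inv_of i hi => rw [map_inv]; exact inv_mem hi
    | mul x y hx hy => rw [map_mul]; exact mul_mem hx hy
  rw [eq_top_iff]
  intro x _
  induction x using Monoid.PushoutI.induction_on with
  | of i g =>
    cases i
    · exact hF g
    · exact hH g
  | base k =>
    rw [← Monoid.PushoutI.of_apply_eq_base (handleMap H h) true k]
    exact hH _
  | mul x y hx hy => exact mul_mem (hx trivial) (hy trivial)

/-- In the group of permutations of `ℤ × H`, left multiplication by `h` on the fibre over `0` is
the commutator of left multiplication by `h` on the fibres over `n ≥ 0` and the shift. -/
theorem ofBase_ne_one (hh : h ≠ 1) : ofBase H h h ≠ 1 := by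
  classical
  let m (P : ℤ → Prop) [DecidablePred P] : H →* Equiv.Perm (ℤ × H) :=
    { toFun := fun k =>
        { toFun := fun p => if P p.1 then (p.1, k * p.2) else p
          invFun := fun p => if P p.1 then (p.1, k⁻¹ * p.2) else p
          left_inv := fun p => by by_cases hp : P p.1 <;> simp [hp]
          right_inv := fun p => by by_cases hp : P p.1 <;> simp [hp] }
      map_one' := by ext1 p; simp
      map_mul' := fun k l => by
        ext1 p
        by_cases hp : P p.1 <;> simp [hp, mul_assoc] }
  let t : Equiv.Perm (ℤ × H) := (Equiv.addRight (1 : ℤ)).prodCongr (Equiv.refl H)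
  have hm : ∀ (P : ℤ → Prop) [DecidablePred P] (k : H) (p : ℤ × H),
    m P k p = if P p.1 then (p.1, k * p.2) else p := fun _ _ _ _ => rfl
  have ht : ∀ p : ℤ × H, t p = (p.1 + 1, p.2) := fun _ => rfl
  obtain ⟨ρ, h1, -, -⟩ := exists_hom (h := h) (m (· = 0)) (m (0 ≤ ·) h) t (by
    rw [commutatorElement_def, eq_mul_inv_iff_mul_eq, eq_mul_inv_iff_mul_eq]
    ext1 p
    obtain ⟨n, x⟩ := p
    simp only [Equiv.Perm.mul_apply, hm, ht]
    by_cases h0 : 0 ≤ n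
    · have : ¬ n + 1 = 0 := by omega
      have : 0 ≤ n + 1 := by omega
      simp [*]
    · by_cases h1 : n + 1 = 0
      · have : n = -1 := by omega
        subst this; simp
      · have : ¬ 0 ≤ n + 1 := by omega
        simp [*])
  intro hc
  have h2 : m (· = 0) h = 1 := by rw [← h1, hc, map_one]
  have h3 := congrArg Prod.snd (Equiv.congr_fun h2 (0, 1))
  simp [hm] at h3
  exact hh h3

theorem isHandle {G : Type v} [Group G] (e : G ≃* HandleAmalgam H h) :
    IsHandle (e.symm.toMonoidHom.comp (ofBase H h)) h
      (e.symm (ofFree H h FreeTwo.a)) (e.symm (ofFree H h FreeTwo.b)) where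
  closure_eq_top := by
    have := congrArg (Subgroup.map e.symm.toMonoidHom) (closure_eq_top (H := H) (h := h))
    rw [MonoidHom.map_closure, Subgroup.map_top_of_surjective _ e.symm.surjective] at this
    rw [← this, Set.image_union, Set.image_pair, ← Set.range_comp]
    rfl
  rel := by
    simp only [MonoidHom.comp_apply, MulEquiv.toMonoidHom_eq_coe,
      MonoidHom.coe_coe]
    rw [ofBase_eq, ← map_mul, ← map_mul, ← map_mul, ← map_mul, ← map_mul, ← map_mul,
      commutatorElement_def]
    group
  exists_hom ψ A B hAB := by
    obtain ⟨ρ, h1, h2, h3⟩ := exists_hom (h := h) ψ A B (by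
      rw [commutatorElement_def, hAB]; group)
    exact ⟨ρ.comp e.toMonoidHom, by simpa using h1, by simpa using h2, by simpa using h3⟩

end HandleAmalgam

/-! ### Realization of a left order by an action on the line -/

namespace OrderIso

/-- The extension to `ℝ` of an order automorphism of `ℚ`, as a function. -/
noncomputable def realExtFun (f : ℚ ≃o ℚ) (x : ℝ) : ℝ :=
  sSup ((fun q : ℚ => (f q : ℝ)) '' {q : ℚ | (q : ℝ) < x})

/-- This determines the value by its rational cut; functoriality and monotonicity then follow
without computing suprema. -/
theorem lt_realExtFun_iff (f : ℚ ≃o ℚ) (q : ℚ) (x : ℝ) :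
    (f q : ℝ) < realExtFun f x ↔ (q : ℝ) < x := by
  have hne : ((fun q : ℚ => (f q : ℝ)) '' {q : ℚ | (q : ℝ) < x}).Nonempty := by
    obtain ⟨q, hq⟩ := exists_rat_lt x
    exact ⟨_, q, hq, rfl⟩
  have hbd : BddAbove ((fun q : ℚ => (f q : ℝ)) '' {q : ℚ | (q : ℝ) < x}) := by
    obtain ⟨r, hr⟩ := exists_rat_gt x
    refine ⟨f r, ?_⟩
    rintro _ ⟨q, hq, rfl⟩
    have : (q : ℝ) < r := lt_trans hq hr
    exact Rat.cast_le.2 (f.lt_iff_lt.2 (Rat.cast_lt.1 this)).le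
  constructor
  · intro hlt
    obtain ⟨_, ⟨p, hp, rfl⟩, hqp⟩ := exists_lt_of_lt_csSup hne hlt
    have : f q < f p := Rat.cast_lt.1 hqp
    have : (q : ℝ) < p := by exact_mod_cast f.lt_iff_lt.1 this
    exact this.trans hp
  · intro hlt
    obtain ⟨p, hqp, hpx⟩ := exists_rat_btwn hlt
    have : f q < f p := f.lt_iff_lt.2 (by exact_mod_cast hqp)
    exact lt_of_lt_of_le (Rat.cast_lt.2 this) (le_csSup hbd ⟨p, hpx, rfl⟩)

theorem eq_of_rat_lt_iff {x y : ℝ} (hxy : ∀ q : ℚ, (q : ℝ) < x ↔ (q : ℝ) < y) : x = y := by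
  apply le_antisymm <;> refine le_of_not_gt fun hlt => ?_
  · obtain ⟨q, h1, h2⟩ := exists_rat_btwn hlt
    exact absurd ((hxy q).1 h2) h1.not_gt
  · obtain ⟨q, h1, h2⟩ := exists_rat_btwn hlt
    exact absurd ((hxy q).2 h2) h1.not_gt

theorem realExtFun_mul (f g : ℚ ≃o ℚ) (x : ℝ) :
    realExtFun (f * g) x = realExtFun f (realExtFun g x) := by
  refine eq_of_rat_lt_iff fun q => ?_
  obtain ⟨p, rfl⟩ := (f * g).surjective q
  rw [lt_realExtFun_iff]
  change _ ↔ ((f (g p) : ℚ) : ℝ) < _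
  rw [lt_realExtFun_iff, lt_realExtFun_iff]

theorem realExtFun_one (x : ℝ) : realExtFun 1 x = x :=
  eq_of_rat_lt_iff fun q => lt_realExtFun_iff 1 q x

theorem realExtFun_rat (f : ℚ ≃o ℚ) (q : ℚ) : realExtFun f q = f q := by
  refine eq_of_rat_lt_iff fun p => ?_
  obtain ⟨p, rfl⟩ := f.surjective p
  rw [lt_realExtFun_iff]
  norm_cast
  exact f.lt_iff_lt.symm

/-- Every order automorphism of `ℚ` extends to `ℝ`, compatibly with composition. -/
noncomputable def realExt : (ℚ ≃o ℚ) →* (ℝ ≃o ℝ) where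
  toFun f :=
    { toFun := realExtFun f
      invFun := realExtFun f⁻¹
      left_inv := fun x => by rw [← realExtFun_mul, inv_mul_cancel, realExtFun_one]
      right_inv := fun x => by rw [← realExtFun_mul, mul_inv_cancel, realExtFun_one]
      map_rel_iff' := by
        intro x y
        refine ⟨fun hle => le_of_forall_rat_lt_imp_le fun q hq => ?_,
          fun hle => le_of_forall_rat_lt_imp_le fun q hq => ?_⟩
        · exact ((lt_realExtFun_iff f q y).1
            (((lt_realExtFun_iff f q x).2 hq).trans_le hle)).le
        · obtain ⟨q, rfl⟩ := f.surjective q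
          exact ((lt_realExtFun_iff f q y).2
            (((lt_realExtFun_iff f q x).1 hq).trans_le hle)).le }
  map_one' := by ext x; exact realExtFun_one x
  map_mul' f g := by ext x; exact realExtFun_mul f g x

theorem realExt_rat (f : ℚ ≃o ℚ) (q : ℚ) : realExt f q = f q := realExtFun_rat f q

end OrderIso

/-! ### Isolated orders yield rigid actions -/

namespace LeftOrder

variable {G : Type v} [Group G]

theorem lt_iff_not_le (o : LeftOrder G) {f g : G} : o.lt f g ↔ ¬ o.le g f := by
  constructor
  · rintro ⟨h1, h2⟩ h3
    exact h2 (o.le_antisymm _ _ h1 h3)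
  · intro h1
    refine ⟨(o.le_total f g).resolve_right h1, ?_⟩
    rintro rfl
    exact h1 (o.le_refl _)

theorem mul_lt_mul_left (o : LeftOrder G) {f k : G} (g : G) (hfk : o.lt f k) :
    o.lt (g * f) (g * k) :=
  ⟨o.mul_le_mul_left _ _ hfk.1 g, fun he => hfk.2 (mul_left_cancel he)⟩

theorem mul_le_mul_left_iff (o : LeftOrder G) {f k : G} (g : G) :
    o.le (g * f) (g * k) ↔ o.le f k := by
  refine ⟨fun hle => ?_, fun hle => o.mul_le_mul_left _ _ hle g⟩
  simpa using o.mul_le_mul_left _ _ hle g⁻¹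

/-- The linear order underlying a left order. -/
noncomputable abbrev toLinearOrder (o : LeftOrder G) : LinearOrder G :=
  { le := o.le
    lt := o.lt
    le_refl := o.le_refl
    le_trans := o.le_trans
    le_antisymm := o.le_antisymm
    le_total := o.le_total
    lt_iff_le_not_ge := fun f g => by
      rw [o.lt_iff_not_le]
      exact ⟨fun h1 => ⟨(o.le_total f g).resolve_right h1, h1⟩, fun h1 => h1.2⟩
    toDecidableLE := Classical.decRel _ }

/-- An action on the line realizes a left order if the order is read off the orbit of `x₀`, and
that orbit is unbounded above. -/
structure IsRealization (o : LeftOrder G) (ρ : G →* (ℝ ≃o ℝ)) (x₀ : ℝ) : Prop where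
  lt_iff : ∀ f k, ρ f x₀ < ρ k x₀ ↔ o.lt f k
  exists_gt : ∀ M, ∃ g, M < ρ g x₀

theorem exists_lt_of_nontrivial [Nontrivial G] (o : LeftOrder G) (g : G) : ∃ k, o.lt g k := by
  obtain ⟨x, hx⟩ := exists_ne (1 : G)
  rcases o.le_total 1 x with h1 | h1
  · exact ⟨g * x, by simpa using o.mul_lt_mul_left g ⟨h1, hx.symm⟩⟩
  · refine ⟨g * x⁻¹, ?_⟩
    have := o.mul_lt_mul_left x⁻¹ ⟨h1, hx⟩
    simpa using o.mul_lt_mul_left g this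

theorem exists_isRealization [Countable G] [Nontrivial G] (o : LeftOrder G) :
    ∃ ρ x₀, o.IsRealization ρ x₀ := by
  let _ := o.toLinearOrder
  have hle : ∀ f g : G, f ≤ g ↔ o.le f g := fun _ _ => Iff.rfl
  have hlt : ∀ f g : G, f < g ↔ o.lt f g := fun _ _ => Iff.rfl
  have : Countable (G ×ₗ ℚ) := inferInstanceAs (Countable (G × ℚ))
  -- The factor `ℚ` makes the lexicographic product dense and without endpoints whatever the order
  -- on `G`, so Cantor's theorem applies.
  obtain ⟨e⟩ := Order.iso_of_countable_dense (G ×ₗ ℚ) ℚ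
  let L : G →* ((G ×ₗ ℚ) ≃o (G ×ₗ ℚ)) :=
    { toFun := fun g =>
        { toFun := fun p => toLex (g * (ofLex p).1, (ofLex p).2)
          invFun := fun p => toLex (g⁻¹ * (ofLex p).1, (ofLex p).2)
          left_inv := fun p => by simp
          right_inv := fun p => by simp
          map_rel_iff' := by
            intro p q
            simp only [Equiv.coe_fn_mk, Prod.Lex.le_iff, hlt, ofLex_toLex]
            rw [o.lt_iff_not_le, o.mul_le_mul_left_iff, ← o.lt_iff_not_le, mul_right_inj] }
      map_one' := by ext p <;> simp
      map_mul' := fun f g => by ext p <;> simp [mul_assoc] }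
  have hL : ∀ g k : G, ∀ q, L g (toLex (k, q)) = toLex (g * k, q) := fun _ _ _ => rfl
  let c : ((G ×ₗ ℚ) ≃o (G ×ₗ ℚ)) →* (ℚ ≃o ℚ) :=
    { toFun := fun f => (e.symm.trans f).trans e
      map_one' := by ext p; simp
      map_mul' := fun f g => by ext p; simp }
  have hc : ∀ f p, c f (e p) = e (f p) := fun f p => by simp [c]
  let x : G ×ₗ ℚ := toLex (1, 0)
  have key : ∀ g, (OrderIso.realExt.comp (c.comp L)) g ((e x : ℚ) : ℝ) =
      ((e (toLex (g, 0)) : ℚ) : ℝ) := by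
    intro g
    simp only [MonoidHom.comp_apply, OrderIso.realExt_rat, hc]
    rw [hL, mul_one]
  refine ⟨OrderIso.realExt.comp (c.comp L), ((e x : ℚ) : ℝ), ?_, ?_⟩
  · intro f k
    rw [key, key, Rat.cast_lt, e.lt_iff_lt, Prod.Lex.lt_iff]
    simp [hlt]
  · intro M
    obtain ⟨q, hq⟩ := exists_rat_gt M
    obtain ⟨p, rfl⟩ := e.surjective q
    obtain ⟨k, hk⟩ := o.exists_lt_of_nontrivial (ofLex p).1
    refine ⟨k, hq.trans ?_⟩
    rw [key, Rat.cast_lt, e.lt_iff_lt, Prod.Lex.lt_iff]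
    exact Or.inl hk

/-- The left order read off the orbit of `x₀` under an action on the line, ties being broken by a
given left order. -/
def ofAction (o : LeftOrder G) (ρ : G →* (ℝ ≃o ℝ)) (x₀ : ℝ) : LeftOrder G where
  le f k := ρ f x₀ < ρ k x₀ ∨ (ρ f x₀ = ρ k x₀ ∧ o.le f k)
  le_refl f := Or.inr ⟨rfl, o.le_refl f⟩
  le_trans f g k := by
    rintro (h1 | ⟨h1, h1'⟩) (h2 | ⟨h2, h2'⟩)
    · exact Or.inl (h1.trans h2)
    · exact Or.inl (h1.trans_eq h2)
    · exact Or.inl (h1.trans_lt h2)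
    · exact Or.inr ⟨h1.trans h2, o.le_trans _ _ _ h1' h2'⟩
  le_antisymm f g := by
    rintro (h1 | ⟨h1, h1'⟩) (h2 | ⟨h2, h2'⟩)
    · exact absurd h1 h2.not_gt
    · exact absurd h2 h1.ne'
    · exact absurd h1 h2.ne'
    · exact o.le_antisymm _ _ h1' h2'
  le_total f g := by
    rcases lt_trichotomy (ρ f x₀) (ρ g x₀) with h1 | h1 | h1
    · exact Or.inl (Or.inl h1)
    · exact (o.le_total f g).imp (fun h2 => Or.inr ⟨h1, h2⟩) (fun h2 => Or.inr ⟨h1.symm, h2⟩)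
    · exact Or.inr (Or.inl h1)
  mul_le_mul_left f k := by
    rintro hfk g
    simp only [map_mul]
    change (ρ g (ρ f x₀) < ρ g (ρ k x₀)) ∨ (ρ g (ρ f x₀) = ρ g (ρ k x₀) ∧ _)
    rw [(ρ g).lt_iff_lt, (ρ g).injective.eq_iff, o.mul_le_mul_left_iff]
    exact hfk

theorem lt_ofAction (o : LeftOrder G) {ρ : G →* (ℝ ≃o ℝ)} {x₀ : ℝ} {f k : G}
    (hfk : ρ f x₀ < ρ k x₀) : (o.ofAction ρ x₀).lt f k :=
  ⟨Or.inl hfk, by rintro rfl; exact lt_irrefl _ hfk⟩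

theorem exists_finite_of_isOpen_singleton {o : LeftOrder G} (ho : IsOpen ({o} : Set (LeftOrder G))) :
    ∃ S : Set G, S.Finite ∧ (∀ s ∈ S, o.lt 1 s) ∧
      ∀ o' : LeftOrder G, (∀ s ∈ S, o'.lt 1 s) → o' = o := by
  have hb := TopologicalSpace.isTopologicalBasis_of_subbasis
    (rfl : (instTopologicalSpace : TopologicalSpace (LeftOrder G)) = _)
  obtain ⟨_, ⟨f, ⟨hf, hfs⟩, rfl⟩, hof, hfo⟩ := hb.exists_subset_of_mem_open
    (Set.mem_singleton o) ho
  choose! s hs using hfs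
  refine ⟨s '' f, hf.image s, ?_, ?_⟩
  · rintro _ ⟨U, hU, rfl⟩
    have : o ∈ U := hof U hU
    rw [hs hU] at this
    exact this
  · intro o' ho'
    refine hfo fun U hU => ?_
    rw [hs hU]
    exact ho' _ ⟨U, hU, rfl⟩

/-- An action on the line is rigid at `x₀` if, for some finite set `S` of group elements, any
action under which the elements of `S` move `x₀` in the same way induces the same order. -/
def IsRigid (ρ : G →* (ℝ ≃o ℝ)) (x₀ : ℝ) : Prop :=
  ∃ S : Set G, S.Finite ∧ ∀ ρ' : G →* (ℝ ≃o ℝ), (∀ s ∈ S, ρ' s x₀ = ρ s x₀) →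
    ∀ f k, ρ' f x₀ < ρ' k x₀ → ρ f x₀ < ρ k x₀

/-- The order read off `ρ'`, with ties broken by `o`, makes the same finite set positive, so it is
`o`. Strict inequalities in the `ρ'`-orbit never involve the tie-break. -/
theorem IsRealization.isRigid {o : LeftOrder G} {ρ : G →* (ℝ ≃o ℝ)} {x₀ : ℝ}
    (hρ : o.IsRealization ρ x₀) (ho : IsOpen ({o} : Set (LeftOrder G))) : IsRigid ρ x₀ := by
  obtain ⟨S, hS, hpos, huniq⟩ := exists_finite_of_isOpen_singleton ho
  refine ⟨S, hS, fun ρ' hρ' f k hfk => ?_⟩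
  have : o.ofAction ρ' x₀ = o := huniq _ fun s hs => o.lt_ofAction (by
    rw [hρ' s hs, map_one]
    have := (hρ.lt_iff 1 s).2 (hpos s hs)
    rwa [map_one] at this)
  rw [hρ.lt_iff, ← this]
  exact o.lt_ofAction hfk

end LeftOrder

/-! ### Homeomorphisms of the line -/

namespace RealOrderIso

theorem mul_apply (f g : ℝ ≃o ℝ) (x : ℝ) : (f * g) x = f (g x) := rfl

@[simp] theorem inv_apply_self (f : ℝ ≃o ℝ) (x : ℝ) : f⁻¹ (f x) = x := f.symm_apply_apply x

@[simp] theorem apply_inv_self (f : ℝ ≃o ℝ) (x : ℝ) : f (f⁻¹ x) = x := f.apply_symm_apply x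

theorem inv_lt_iff (f : ℝ ≃o ℝ) {x y : ℝ} : f⁻¹ x < y ↔ x < f y := by
  rw [← f.lt_iff_lt, apply_inv_self]

theorem lt_inv_iff (f : ℝ ≃o ℝ) {x y : ℝ} : x < f⁻¹ y ↔ f x < y := by
  rw [← f.lt_iff_lt, apply_inv_self]

theorem inv_le_iff (f : ℝ ≃o ℝ) {x y : ℝ} : f⁻¹ x ≤ y ↔ x ≤ f y := by
  rw [← f.le_iff_le, apply_inv_self]

theorem le_inv_iff (f : ℝ ≃o ℝ) {x y : ℝ} : x ≤ f⁻¹ y ↔ f x ≤ y := by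
  rw [← f.le_iff_le, apply_inv_self]

theorem inv_eq_iff (f : ℝ ≃o ℝ) {x y : ℝ} : f⁻¹ x = y ↔ x = f y := by
  rw [← f.injective.eq_iff, apply_inv_self]

theorem pow_succ_apply (f : ℝ ≃o ℝ) (n : ℕ) (x : ℝ) : (f ^ (n + 1)) x = f ((f ^ n) x) := by
  rw [pow_succ']; rfl

theorem pow_succ_apply' (f : ℝ ≃o ℝ) (n : ℕ) (x : ℝ) : (f ^ (n + 1)) x = (f ^ n) (f x) := by
  rw [pow_succ]; rfl

theorem pow_add_apply (f : ℝ ≃o ℝ) (n k : ℕ) (x : ℝ) :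
    (f ^ (n + k)) x = (f ^ n) ((f ^ k) x) := by
  rw [pow_add]; rfl

/-- The order automorphism that follows `f` up to `c` and `g` from `c` on. -/
noncomputable def glue (c : ℝ) (f g : ℝ ≃o ℝ) (h : f c = g c) : ℝ ≃o ℝ :=
  StrictMono.orderIsoOfSurjective (fun x => if x ≤ c then f x else g x)
    (by
      intro x y hxy
      dsimp only
      split_ifs with h1 h2 h2
      · exact f.lt_iff_lt.2 hxy
      · exact lt_of_le_of_lt (f.le_iff_le.2 h1) (h ▸ g.lt_iff_lt.2 (not_le.1 h2))
      · exact absurd (hxy.le.trans h2) h1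
      · exact g.lt_iff_lt.2 hxy)
    (by
      intro z
      rcases le_or_gt z (f c) with hz | hz
      · exact ⟨f⁻¹ z, by dsimp only; rw [if_pos ((inv_le_iff f).2 hz), apply_inv_self]⟩
      · refine ⟨g⁻¹ z, ?_⟩
        dsimp only
        rw [if_neg (not_le.2 ((lt_inv_iff g).2 (h ▸ hz))), apply_inv_self])

theorem glue_of_le {c : ℝ} {f g : ℝ ≃o ℝ} {h : f c = g c} {x : ℝ} (hx : x ≤ c) :
    glue c f g h x = f x := if_pos hx

theorem glue_of_ge {c : ℝ} {f g : ℝ ≃o ℝ} {h : f c = g c} {x : ℝ} (hx : c ≤ x) :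
    glue c f g h x = g x := by
  rcases hx.eq_or_lt with rfl | hx
  · rw [glue_of_le le_rfl, h]
  · exact if_neg (not_le.2 hx)

/-- The pointwise minimum of two order automorphisms. -/
noncomputable def minIso (f g : ℝ ≃o ℝ) : ℝ ≃o ℝ :=
  StrictMono.orderIsoOfSurjective (fun x => min (f x) (g x))
    (fun _ _ hxy => min_lt_min (f.lt_iff_lt.2 hxy) (g.lt_iff_lt.2 hxy))
    (fun z => ⟨max (f⁻¹ z) (g⁻¹ z), by
      rcases le_total (f⁻¹ z) (g⁻¹ z) with hz | hz
      · simp only [max_eq_right hz, apply_inv_self]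
        exact min_eq_right ((inv_le_iff f).1 hz)
      · simp only [max_eq_left hz, apply_inv_self]
        exact min_eq_left ((inv_le_iff g).1 hz)⟩)

/-- The pointwise maximum of two order automorphisms. -/
noncomputable def maxIso (f g : ℝ ≃o ℝ) : ℝ ≃o ℝ :=
  StrictMono.orderIsoOfSurjective (fun x => max (f x) (g x))
    (fun _ _ hxy => max_lt_max (f.lt_iff_lt.2 hxy) (g.lt_iff_lt.2 hxy))
    (fun z => ⟨min (f⁻¹ z) (g⁻¹ z), by
      rcases le_total (f⁻¹ z) (g⁻¹ z) with hz | hz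
      · simp only [min_eq_left hz, apply_inv_self]
        exact max_eq_left ((le_inv_iff g).1 hz)
      · simp only [min_eq_right hz, apply_inv_self]
        exact max_eq_right ((le_inv_iff f).1 hz)⟩)

/-- The contraction `x ↦ (c + x) / 2` towards `c`. -/
noncomputable def contract (c : ℝ) : ℝ ≃o ℝ where
  toFun x := (c + x) / 2
  invFun x := 2 * x - c
  left_inv x := by ring
  right_inv x := by ring
  map_rel_iff' := by
    intro x y
    change (c + x) / 2 ≤ (c + y) / 2 ↔ x ≤ y
    constructor <;> intro hxy <;> linarith

theorem contract_apply (c x : ℝ) : contract c x = (c + x) / 2 := rfl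

/-- Up to a translation, the larger of the identity and `f`, the translation being chosen so that
`c` is mapped to `d`. -/
noncomputable def maxIdTrans (f : ℝ ≃o ℝ) (c d : ℝ) : ℝ ≃o ℝ :=
  (maxIso 1 f).trans (OrderIso.addRight (d - max c (f c)))

theorem maxIdTrans_apply (f : ℝ ≃o ℝ) (c d x : ℝ) :
    maxIdTrans f c d x = max x (f x) + (d - max c (f c)) := rfl

theorem maxIdTrans_self (f : ℝ ≃o ℝ) (c d : ℝ) : maxIdTrans f c d c = d := by
  rw [maxIdTrans_apply]; ring

theorem lt_maxIdTrans {f : ℝ ≃o ℝ} {c d : ℝ} (h1 : c < d) (h2 : f c < d) (x : ℝ) :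
    x < maxIdTrans f c d x ∧ f x < maxIdTrans f c d x := by
  rw [maxIdTrans_apply]
  have := max_lt h1 h2
  have := le_max_left x (f x)
  have := le_max_right x (f x)
  constructor <;> linarith

theorem exists_lt_pow_apply (f : ℝ ≃o ℝ) {m c : ℝ} (h : ∀ x ∈ Set.Icc m c, x < f x) :
    ∃ n : ℕ, c < (f ^ n) m := by
  by_contra! hc
  have hne : (Set.range fun n : ℕ => (f ^ n) m).Nonempty := Set.range_nonempty _
  have hbd : BddAbove (Set.range fun n : ℕ => (f ^ n) m) := ⟨c, by rintro _ ⟨n, rfl⟩; exact hc n⟩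
  set s := sSup (Set.range fun n : ℕ => (f ^ n) m)
  have h0 : m ≤ s := le_csSup hbd ⟨0, rfl⟩
  have h1 : s ≤ c := csSup_le hne (by rintro _ ⟨n, rfl⟩; exact hc n)
  -- Some iterate exceeds `f⁻¹ s`, so the next one exceeds the supremum `s`.
  have h2 : f⁻¹ s < s := (inv_lt_iff f).2 (h s ⟨h0, h1⟩)
  obtain ⟨_, ⟨n, rfl⟩, hn⟩ := exists_lt_of_lt_csSup hne h2
  have h3 : (f ^ (n + 1)) m ≤ s := le_csSup hbd ⟨n + 1, rfl⟩
  rw [pow_succ_apply] at h3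
  exact absurd ((inv_lt_iff f).1 hn) h3.not_gt

theorem exists_pow_apply_eq (f : ℝ ≃o ℝ) {m x : ℝ} (h : ∀ z ∈ Set.Icc m x, z < f z) :
    ∃ n : ℕ, ∃ w ≤ m, (f ^ n) w = x := by
  obtain ⟨n, hn⟩ := exists_lt_pow_apply f h
  exact ⟨n, (f ^ n)⁻¹ x, ((inv_lt_iff _).2 hn).le, apply_inv_self _ _⟩

theorem pow_apply_lt (f : ℝ ≃o ℝ) {y : ℝ} (hy : f y = y) {x : ℝ} (hx : x < y) (n : ℕ) :
    (f ^ n) x < y := by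
  induction n with
  | zero => exact hx
  | succ n ih => rw [pow_succ_apply, ← hy]; exact f.lt_iff_lt.2 ih

/-! ### Extension of conjugacies along iterates -/

section ConjugacyExtension

variable {f g B : ℝ ≃o ℝ} {m : ℝ}

theorem apply_pow_eq (hf : m < f m) (hrel : ∀ x ≤ m, f x ≤ m → B (f x) = g (B x)) (n : ℕ) {x : ℝ}
    (hx' : (f ^ n) x ≤ m) : B ((f ^ n) x) = (g ^ n) (B x) := by
  induction n with
  | zero => rfl
  | succ n ih =>
    rw [pow_succ_apply] at hx'
    have h1 : (f ^ n) x ≤ m := by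
      rw [← f.le_iff_le]; exact hx'.trans hf.le
    rw [pow_succ_apply, pow_succ_apply, hrel _ h1 hx', ih h1]

theorem pow_apply_eq_of_le (hf : m < f m) (hrel : ∀ x ≤ m, f x ≤ m → B (f x) = g (B x))
    {n k : ℕ} (hnk : n ≤ k) {x y : ℝ} (hx : x ≤ m) (h : (f ^ n) x = (f ^ k) y) :
    (g ^ n) (B x) = (g ^ k) (B y) := by
  obtain ⟨j, rfl⟩ := Nat.exists_eq_add_of_le hnk
  rw [pow_add_apply] at h ⊢
  have h' := (f ^ n).injective h
  rw [← apply_pow_eq hf hrel j (h' ▸ hx), ← h']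

/-- This makes the formula `F (f ^ n w) = g ^ n (B w)`, for `w ≤ m`, independent of the chosen `n`
and `w`. -/
theorem pow_apply_eq (hf : m < f m) (hrel : ∀ x ≤ m, f x ≤ m → B (f x) = g (B x))
    {n k : ℕ} {x y : ℝ} (hx : x ≤ m) (hy : y ≤ m) (h : (f ^ n) x = (f ^ k) y) :
    (g ^ n) (B x) = (g ^ k) (B y) := by
  rcases le_total n k with hnk | hnk
  · exact pow_apply_eq_of_le hf hrel hnk hx h
  · exact (pow_apply_eq_of_le hf hrel hnk hy h.symm).symm

/-- A conjugacy from `f` to `g` on a half-line `(-∞, m]` extends to the union of the images of that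
half-line under the powers of `f`. -/
theorem exists_conj_extension (hf : m < f m)
    (hrel : ∀ x ≤ m, f x ≤ m → B (f x) = g (B x)) {S T : Set ℝ}
    (hS : ∀ x ∈ S, ∃ n : ℕ, ∃ w ≤ m, (f ^ n) w = x)
    (hT : ∀ z ∈ T, ∃ n : ℕ, ∃ w ≤ B m, (g ^ n) w = z)
    (hS' : ∀ n : ℕ, ∀ w ≤ m, (f ^ n) w ∈ S) (hT' : ∀ n : ℕ, ∀ w ≤ B m, (g ^ n) w ∈ T) :
    ∃ F : ℝ → ℝ, (∀ x ≤ m, F x = B x) ∧ (∀ x ∈ S, F (f x) = g (F x)) ∧ StrictMonoOn F S ∧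
      F '' S = T := by
  classical
  choose! n w hwm hw using hS
  let F : ℝ → ℝ := fun x => (g ^ n x) (B (w x))
  have hF : ∀ k : ℕ, ∀ v ≤ m, F ((f ^ k) v) = (g ^ k) (B v) := fun k v hv =>
    pow_apply_eq hf hrel (hwm _ (hS' k v hv)) hv (hw _ (hS' k v hv))
  refine ⟨F, fun x hx => hF 0 x hx, ?_, ?_, ?_⟩
  · intro x hx
    have := hF (n x + 1) (w x) (hwm x hx)
    rw [pow_succ_apply, hw x hx, pow_succ_apply] at this
    exact this
  -- Any two points can be written with a common exponent, which reduces monotonicity of `F` to that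
  -- of `B`.
  · have up : ∀ j k : ℕ, ∀ v ≤ m, ∃ v' ≤ m, (f ^ (j + k)) v' = (f ^ k) v := by
      intro j
      induction j with
      | zero => exact fun k v hv => ⟨v, hv, by rw [zero_add]⟩
      | succ j ih =>
        intro k v hv
        obtain ⟨v', hv', he⟩ := ih k v hv
        refine ⟨f⁻¹ v', (inv_le_iff f).2 (hv'.trans hf.le), ?_⟩
        rw [add_right_comm, pow_succ_apply', apply_inv_self, he]
    intro x hx y hy hxy
    obtain ⟨v, hv, hvx⟩ := up (n y) (n x) (w x) (hwm x hx)
    obtain ⟨v', hv', hvy⟩ := up (n x) (n y) (w y) (hwm y hy)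
    rw [hw x hx] at hvx
    rw [hw y hy, add_comm] at hvy
    have hFx := hF (n y + n x) v hv
    have hFy := hF (n y + n x) v' hv'
    rw [hvx] at hFx
    rw [hvy] at hFy
    rw [hFx, hFy, (g ^ _).lt_iff_lt, B.lt_iff_lt, ← (f ^ (n y + n x)).lt_iff_lt, hvx, hvy]
    exact hxy
  · ext z
    constructor
    · rintro ⟨x, hx, rfl⟩
      exact hT' _ _ (B.le_iff_le.2 (hwm x hx))
    · intro hz
      obtain ⟨k, v, hv, rfl⟩ := hT z hz
      have hv' : B⁻¹ v ≤ m := (inv_le_iff B).2 hv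
      exact ⟨(f ^ k) (B⁻¹ v), hS' _ _ hv', by rw [hF _ _ hv', apply_inv_self]⟩

theorem exists_conj_extension_univ (hf : ∀ x, m ≤ x → x < f x) (hg : ∀ x, B m ≤ x → x < g x)
    (hrel : ∀ x ≤ m, f x ≤ m → B (f x) = g (B x)) :
    ∃ F : ℝ ≃o ℝ, (∀ x ≤ m, F x = B x) ∧ F * f = g * F := by
  obtain ⟨F, h1, h2, h3, h4⟩ := exists_conj_extension (S := Set.univ) (T := Set.univ)
    (hf m le_rfl) hrel
    (fun x _ => exists_pow_apply_eq f fun z hz => hf z hz.1)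
    (fun x _ => exists_pow_apply_eq g fun z hz => hg z hz.1)
    (fun _ _ _ => trivial) (fun _ _ _ => trivial)
  refine ⟨StrictMono.orderIsoOfSurjective F (strictMonoOn_univ.1 h3)
    (by rwa [Set.image_univ, Set.range_eq_univ] at h4), h1, ?_⟩
  ext x
  exact h2 x trivial

theorem exists_conj_extension_Iio {y y' : ℝ} (hmy : m < y) (hmy' : B m < y')
    (hf : ∀ x ∈ Set.Ico m y, x < f x) (hfy : f y = y)
    (hg : ∀ x ∈ Set.Ico (B m) y', x < g x) (hgy : g y' = y')
    (hrel : ∀ x ≤ m, f x ≤ m → B (f x) = g (B x)) :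
    ∃ F : ℝ → ℝ, (∀ x ≤ m, F x = B x) ∧ (∀ x < y, F (f x) = g (F x)) ∧
      StrictMonoOn F (Set.Iio y) ∧ F '' Set.Iio y = Set.Iio y' :=
  exists_conj_extension (hf m ⟨le_rfl, hmy⟩) hrel
    (fun _ hx => exists_pow_apply_eq f fun z hz => hf z ⟨hz.1, hz.2.trans_lt hx⟩)
    (fun _ hx => exists_pow_apply_eq g fun z hz => hg z ⟨hz.1, hz.2.trans_lt hx⟩)
    (fun n _ hw => pow_apply_lt f hfy (hw.trans_lt hmy) n)
    (fun n _ hw => pow_apply_lt g hgy (hw.trans_lt hmy') n)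

/-- A strictly monotone bijection from `(-∞, y)` to `(-∞, y')` can be continued above `y` by any
order automorphism taking `y` to `y'`. -/
theorem exists_orderIso_of_Iio {F : ℝ → ℝ} {y y' : ℝ} (hF : StrictMonoOn F (Set.Iio y))
    (hF' : F '' Set.Iio y = Set.Iio y') (g : ℝ ≃o ℝ) (hg : g y = y') :
    ∃ K : ℝ ≃o ℝ, (∀ x < y, K x = F x) ∧ ∀ x, y ≤ x → K x = g x := by
  classical
  have hlt : ∀ x < y, F x < y' := fun x hx => hF'.subset ⟨x, hx, rfl⟩
  let K : ℝ → ℝ := fun x => if x < y then F x else g x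
  have h1 : ∀ x < y, K x = F x := fun x hx => if_pos hx
  have h2 : ∀ x, y ≤ x → K x = g x := fun x hx => if_neg (not_lt.2 hx)
  have hmono : StrictMono K := by
    intro x z hxz
    rcases lt_or_ge z y with hz | hz
    · rw [h1 x (hxz.trans hz), h1 z hz]; exact hF (hxz.trans hz) hz hxz
    rcases lt_or_ge x y with hx | hx
    · rw [h1 x hx, h2 z hz]
      exact (hlt x hx).trans_le (hg ▸ g.le_iff_le.2 hz)
    · rw [h2 x hx, h2 z hz]; exact g.lt_iff_lt.2 hxz
  have hsurj : Function.Surjective K := by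
    intro z
    rcases lt_or_ge z y' with hz | hz
    · obtain ⟨x, hx, rfl⟩ := hF'.superset hz
      exact ⟨x, h1 x hx⟩
    · exact ⟨g⁻¹ z, by rw [h2 _ ((le_inv_iff g).2 (hg.trans_le hz)), apply_inv_self]⟩
  exact ⟨StrictMono.orderIsoOfSurjective K hmono hsurj, h1, h2⟩

end ConjugacyExtension

/-! ### Modification of a pair with prescribed commutator -/

/-- If `A` moves `[m, B m]` upwards, then the pair `(A, B)` can be changed above `m`, preserving
its commutator, so that `A` moves all points above `m` upwards. -/
theorem exists_perturbation_up {A B C : ℝ ≃o ℝ} (hrel : A * B = C * B * A) {m : ℝ}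
    (hm : m ≤ B m) (hA : ∀ x ∈ Set.Icc m (B m), x < A x) :
    ∃ A' B' : ℝ ≃o ℝ, A' * B' = C * B' * A' ∧ (∀ x ≤ m, A' x = A x) ∧ (∀ x ≤ m, B' x = B x) ∧
      ∀ x, m ≤ x → x < A' x := by
  have hr : ∀ x, A (B x) = C (B (A x)) := fun x => DFunLike.congr_fun hrel x
  have hAt := hA (B m) ⟨hm, le_rfl⟩
  have hCt : C (B m) < A (B m) := by
    rw [hr, C.lt_iff_lt, B.lt_iff_lt]; exact hA m ⟨le_rfl, hm⟩
  -- Above `B m` the new map exceeds the identity and also `C`: its conjugate `C⁻¹ A'` must move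
  -- those points up too.
  let A' := glue (B m) A (maxIdTrans C (B m) (A (B m))) (maxIdTrans_self _ _ _).symm
  have hle : ∀ x ≤ B m, A' x = A x := fun x hx => glue_of_le hx
  have hge : ∀ x, B m ≤ x → x < A' x ∧ C x < A' x := fun x hx => by
    rw [show A' x = _ from glue_of_ge hx]; exact lt_maxIdTrans hAt hCt x
  have hup : ∀ x, m ≤ x → x < A' x := by
    intro x hx
    rcases le_total x (B m) with h1 | h1
    · rw [hle x h1]; exact hA x ⟨hx, h1⟩
    · exact (hge x h1).1
  obtain ⟨B', h1, h2⟩ := exists_conj_extension_univ (f := A') (g := C⁻¹ * A') (B := B) hup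
    (fun x hx => by rw [mul_apply, lt_inv_iff]; exact (hge x hx).2)
    (fun x hx _ => by
      rw [mul_apply, hle x (hx.trans hm), hle _ (B.le_iff_le.2 hx), hr, inv_apply_self])
  refine ⟨A', B', ?_, fun x hx => hle x (hx.trans hm), h1, hup⟩
  rw [mul_assoc, h2]
  group

/-- If `A` and `C⁻¹ A` move all points above `m` and `B m` upwards, and `C y < y` for a large `y`,
then the pair `(A, B)` can be changed above `m`, preserving its commutator, so that `A` fixes `y`,
which is moved upwards by `B`. -/
theorem exists_perturbation_fixed {A B C : ℝ ≃o ℝ} (hrel : A * B = C * B * A) {m y : ℝ}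
    (hm : m ≤ B m) (hA : ∀ x, m ≤ x → x < A x) (hy : 2 * A (B m) - B m ≤ y) (hCy : C y < y) :
    ∃ A' B' : ℝ ≃o ℝ, A' * B' = C * B' * A' ∧ (∀ x ≤ m, A' x = A x) ∧ (∀ x ≤ m, B' x = B x) ∧
      A' y = y ∧ y < B' y ∧ ∀ x ∈ Set.Ico m y, x < A' x := by
  have hr : ∀ x, A (B x) = C (B (A x)) := fun x => DFunLike.congr_fun hrel x
  set t := B m with ht
  have hAt := hA t hm
  have hty : t < y := by linarith
  have hmy : m < y := hm.trans_lt hty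
  have hCA : ∀ x, t ≤ x → C x < A x := by
    intro x hx
    have h1 := hA (B⁻¹ x) ((le_inv_iff B).2 hx)
    rw [← B.lt_iff_lt, ← C.lt_iff_lt, ← hr, apply_inv_self] at h1
    exact h1
  -- `A₀` agrees with `A` up to `t` and fixes `y`.
  let A₀ := glue t A (minIso A ((maxIso 1 C).trans (contract y))) (by
    -- The bound `2 * A t - t ≤ y` serves to make the minimum equal to `A t` at `t`.
    refine (min_eq_left ?_).symm
    have : t ≤ max t (C t) := le_max_left _ _
    change A t ≤ (y + max t (C t)) / 2
    linarith)
  have hA₀le : ∀ x ≤ t, A₀ x = A x := fun x hx => glue_of_le hx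
  have hA₀ge : ∀ x, t ≤ x → A₀ x = min (A x) ((y + max x (C x)) / 2) := fun x hx => glue_of_ge hx
  have hA₀y : A₀ y = y := by
    rw [hA₀ge y hty.le, max_eq_left hCy.le, add_self_div_two]
    exact min_eq_right (hA y hmy.le).le
  have hA₀lt : ∀ x, t ≤ x → x < y → x < A₀ x ∧ C x < A₀ x := by
    intro x hx hxy
    have h1 : max x (C x) < y := max_lt hxy ((C.lt_iff_lt.2 hxy).trans hCy)
    have h2 := le_max_left x (C x)
    have h3 := le_max_right x (C x)
    rw [hA₀ge x hx]
    exact ⟨lt_min (hA x (hm.trans hx)) (by linarith), lt_min (hCA x hx) (by linarith)⟩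
  -- `E` agrees with `C⁻¹ A₀` up to `y` and fixes `y'`.
  have hy₁ : y < C⁻¹ y := (lt_inv_iff C).2 hCy
  -- With this value the contraction towards `y'` takes `y` to `C⁻¹ y = C⁻¹ (A₀ y)`, so the two
  -- pieces of `E` match.
  set y' := 2 * C⁻¹ y - y with hy'
  have hyy' : y < y' := by linarith
  let E := glue y (C⁻¹ * A₀) (contract y') (by
    rw [mul_apply, hA₀y, contract_apply]; linarith)
  have hEle : ∀ x ≤ y, E x = C⁻¹ (A₀ x) := fun x hx => glue_of_le hx
  have hEge : ∀ x, y ≤ x → E x = (y' + x) / 2 := fun x hx => glue_of_ge hx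
  have hEy' : E y' = y' := by rw [hEge y' hyy'.le]; ring
  have hElt : ∀ x ∈ Set.Ico t y', x < E x := by
    rintro x ⟨h1, h2⟩
    rcases lt_or_ge x y with h3 | h3
    · rw [hEle x h3.le, lt_inv_iff]; exact (hA₀lt x h1 h3).2
    · rw [hEge x h3]; linarith
  -- Now `C⁻¹ A₁ = E` has the fixed point `y'`, to which the conjugacy must take the fixed point `y`
  -- of `A₁`.
  let A₁ := C * E
  have hA₁ : ∀ x, A₁ x = C (E x) := fun _ => rfl
  have hA₁le : ∀ x ≤ y, A₁ x = A₀ x := fun x hx => by rw [hA₁, hEle x hx, apply_inv_self]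
  have hA₁y : A₁ y = y := by rw [hA₁le y le_rfl, hA₀y]
  have hA₁lt : ∀ x ∈ Set.Ico m y, x < A₁ x := by
    rintro x ⟨h1, h2⟩
    rw [hA₁le x h2.le]
    rcases le_total x t with h3 | h3
    · rw [hA₀le x h3]; exact hA x h1
    · exact (hA₀lt x h3 h2).1
  obtain ⟨F, hFm, hFE, hFmono, hFim⟩ := exists_conj_extension_Iio (f := A₁) (g := E) (B := B)
    hmy (hty.trans hyy') hA₁lt hA₁y hElt hEy' (fun x hx _ => by
      have hBx : B x ≤ t := B.le_iff_le.2 hx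
      have h1 : A₁ x = A x := by
        rw [hA₁le x (hx.trans hmy.le), hA₀le x (hx.trans hm)]
      rw [h1, hEle _ (hBx.trans hty.le), hA₀le _ hBx, hr, inv_apply_self])
  -- Above `y` no conjugacy is required yet. It is enough that `B'` exceeds the identity and `C⁻¹`,
  -- so that `B'` and `C B'` move up the points over which `A'` will be extended.
  obtain ⟨B', hB'lt, hB'ge⟩ := exists_orderIso_of_Iio hFmono hFim (maxIdTrans C⁻¹ y y')
    (maxIdTrans_self _ _ _)
  have hB'y : B' y = y' := by rw [hB'ge y le_rfl, maxIdTrans_self]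
  have hB'up : ∀ x, y ≤ x → x < B' x ∧ C⁻¹ x < B' x := by
    intro x hx
    rw [hB'ge x hx]
    exact lt_maxIdTrans hyy' (by linarith) x
  have hrel₁ : ∀ x ≤ y, A₁ (B' x) = C (B' (A₁ x)) := by
    intro x hx
    rcases hx.lt_or_eq with hx | rfl
    · have h1 : A₁ x < y := by rw [← hA₁y]; exact A₁.lt_iff_lt.2 hx
      rw [hB'lt x hx, hB'lt _ h1, hFE x hx, hA₁]
    · rw [hA₁y, hB'y, hA₁, hEy']
  have hyCy' : y < C y' := by
    rw [← inv_lt_iff]; linarith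
  -- The roles are exchanged: the relation also says that `A'` conjugates `B'` to `C B'`. So `A₁` on
  -- `(-∞, y']` is transported along the iterates of `B'`. The relation is needed only where `B' x ≤
  -- y' = B' y`, that is, for `x ≤ y`.
  obtain ⟨A', hA'le, hA'⟩ := exists_conj_extension_univ (f := B') (g := C * B') (B := A₁) (m := y')
    (fun x hx => (hB'up x (hyy'.le.trans hx)).1)
    (fun x hx => by
      rw [hA₁, hEy'] at hx
      rw [mul_apply, ← inv_lt_iff]; exact (hB'up x (hyCy'.le.trans hx)).2)
    (fun x _ hx => hrel₁ x (B'.le_iff_le.1 (hx.trans_eq hB'y.symm)))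
  refine ⟨A', B', hA', fun x hx => ?_, fun x hx => ?_, ?_, hB'y ▸ hyy', fun x hx => ?_⟩
  · rw [hA'le x ((hx.trans hmy.le).trans hyy'.le), hA₁le x (hx.trans hmy.le), hA₀le x (hx.trans hm)]
  · rw [hB'lt x (hx.trans_lt hmy), hFm x hx]
  · rw [hA'le y hyy'.le, hA₁y]
  · rw [hA'le x (hx.2.le.trans hyy'.le)]; exact hA₁lt x hx

end RealOrderIso

/-! ### Behaviour of homeomorphisms near infinity -/

namespace RealOrderIso

/-- All large points are moved upwards. -/
def EventuallyUp (f : ℝ ≃o ℝ) : Prop := ∃ u, ∀ x, u ≤ x → x < f x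

/-- All large points are moved downwards. -/
def EventuallyDown (f : ℝ ≃o ℝ) : Prop := ∃ u, ∀ x, u ≤ x → f x < x

/-- There are arbitrarily large fixed points. -/
def FixedUnbounded (f : ℝ ≃o ℝ) : Prop := ∀ u, ∃ x, u ≤ x ∧ f x = x

theorem exists_fixed_of_le_of_le (f : ℝ ≃o ℝ) {x y : ℝ} (hx : f x ≤ x) (hy : y ≤ f y) :
    ∃ z ∈ Set.uIcc x y, f z = z := by
  have hc : ContinuousOn (fun z => f z - z) (Set.uIcc x y) :=
    (f.continuous.sub continuous_id).continuousOn
  have h0 : (0 : ℝ) ∈ Set.uIcc (f x - x) (f y - y) := by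
    rw [Set.mem_uIcc]; left; constructor <;> linarith
  obtain ⟨z, hz, hz0⟩ := intermediate_value_uIcc hc h0
  exact ⟨z, hz, sub_eq_zero.1 hz0⟩

theorem up_or_down_of_ne (f : ℝ ≃o ℝ) {S : Set ℝ} [S.OrdConnected] (h : ∀ x ∈ S, f x ≠ x) :
    (∀ x ∈ S, x < f x) ∨ ∀ x ∈ S, f x < x := by
  by_contra! hc
  obtain ⟨⟨x, hx, hx'⟩, y, hy, hy'⟩ := hc
  obtain ⟨z, hz, hz'⟩ := exists_fixed_of_le_of_le f hx' hy'
  exact h z (Set.OrdConnected.uIcc_subset ‹_› hx hy hz) hz'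

theorem trichotomy_infinity (f : ℝ ≃o ℝ) :
    FixedUnbounded f ∨ EventuallyUp f ∨ EventuallyDown f := by
  by_cases hf : FixedUnbounded f
  · exact Or.inl hf
  · unfold FixedUnbounded at hf
    push Not at hf
    obtain ⟨u, hu⟩ := hf
    rcases up_or_down_of_ne f (S := Set.Ici u) hu with h | h
    · exact Or.inr (Or.inl ⟨u, h⟩)
    · exact Or.inr (Or.inr ⟨u, h⟩)

theorem FixedUnbounded.conj {f : ℝ ≃o ℝ} (hf : FixedUnbounded f) (g : ℝ ≃o ℝ) :
    FixedUnbounded (g * f * g⁻¹) := by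
  intro u
  obtain ⟨x, hx, hfx⟩ := hf (g⁻¹ u)
  exact ⟨g x, (inv_le_iff g).1 hx, by simp [mul_apply, hfx]⟩

theorem FixedUnbounded.inv {f : ℝ ≃o ℝ} (hf : FixedUnbounded f) : FixedUnbounded f⁻¹ := by
  intro u
  obtain ⟨x, hx, hfx⟩ := hf u
  exact ⟨x, hx, (inv_eq_iff f).2 hfx.symm⟩

theorem EventuallyUp.conj {f : ℝ ≃o ℝ} (hf : EventuallyUp f) (g : ℝ ≃o ℝ) :
    EventuallyUp (g * f * g⁻¹) := by
  obtain ⟨u, hu⟩ := hf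
  refine ⟨g u, fun x hx => ?_⟩
  simp only [mul_apply]
  rw [← inv_lt_iff]
  exact hu _ ((le_inv_iff g).2 hx)

theorem EventuallyDown.conj {f : ℝ ≃o ℝ} (hf : EventuallyDown f) (g : ℝ ≃o ℝ) :
    EventuallyDown (g * f * g⁻¹) := by
  obtain ⟨u, hu⟩ := hf
  refine ⟨g u, fun x hx => ?_⟩
  simp only [mul_apply]
  rw [← lt_inv_iff]
  exact hu _ ((le_inv_iff g).2 hx)

theorem EventuallyDown.inv {f : ℝ ≃o ℝ} (hf : EventuallyDown f) : EventuallyUp f⁻¹ := by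
  obtain ⟨u, hu⟩ := hf
  exact ⟨u, fun x hx => (lt_inv_iff f).2 (hu x hx)⟩

end RealOrderIso

open RealOrderIso

/-! ### Rigid actions of groups with a handle -/

section Handle

variable {G : Type v} [Group G] {H : Type u} [Group H] {ι : H →* G} {h : H} {a b : G}
  {ρ ρ' : G →* (ℝ ≃o ℝ)} {x₀ : ℝ}

theorem map_pow_mul_apply (ρ : G →* (ℝ ≃o ℝ)) (a g : G) (n : ℕ) (x : ℝ) :
    ρ (a ^ n * g) x = (ρ a ^ n) (ρ g x) := by
  rw [map_mul, map_pow]; rfl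

/-- The actions `ρ` and `ρ'` agree on `H`, and the images of `a` and `b` agree below `M`. -/
structure AgreeBelow (ι : H →* G) (a b : G) (ρ ρ' : G →* (ℝ ≃o ℝ)) (M : ℝ) : Prop where
  base : ∀ k, ρ' (ι k) = ρ (ι k)
  left : ∀ x ≤ M, ρ' a x = ρ a x
  right : ∀ x ≤ M, ρ' b x = ρ b x

theorem AgreeBelow.mono {M N : ℝ} (hM : AgreeBelow ι a b ρ ρ' M) (hNM : N ≤ M) :
    AgreeBelow ι a b ρ ρ' N :=
  ⟨hM.base, fun x hx => hM.left x (hx.trans hNM), fun x hx => hM.right x (hx.trans hNM)⟩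

namespace IsHandle

theorem rel_map (hab : IsHandle ι h a b) (ρ : G →* (ℝ ≃o ℝ)) :
    ρ a * ρ b = ρ (ι h) * ρ b * ρ a := by
  rw [← map_mul, hab.rel, map_mul, map_mul]

theorem exists_agreeBelow (hab : IsHandle ι h a b) {A B : ℝ ≃o ℝ} {M : ℝ}
    (hAB : A * B = ρ (ι h) * B * A) (hA : ∀ x ≤ M, A x = ρ a x) (hB : ∀ x ≤ M, B x = ρ b x) :
    ∃ ρ', AgreeBelow ι a b ρ ρ' M ∧ ρ' a = A ∧ ρ' b = B := by
  obtain ⟨ρ', h1, h2, h3⟩ := hab.exists_hom (ρ.comp ι) A B hAB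
  exact ⟨ρ', ⟨h1, h2 ▸ hA, h3 ▸ hB⟩, h2, h3⟩

/-- The action of a given element on a given point depends only on the restrictions of the
generators `a` and `b` to some half-line. -/
theorem exists_bound (hab : IsHandle ι h a b) (ρ : G →* (ℝ ≃o ℝ)) (g : G) (x : ℝ) :
    ∃ M, ∀ ρ', AgreeBelow ι a b ρ ρ' M → ρ' g x = ρ g x := by
  have hg : g ∈ Subgroup.closure (Set.range ι ∪ {a, b}) := by
    rw [hab.closure_eq_top]; trivial
  induction hg using Subgroup.closure_induction generalizing x with
  | mem g hg =>
    rcases hg with ⟨k, rfl⟩ | rfl | rfl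
    · exact ⟨0, fun ρ' hρ' => by rw [hρ'.base]⟩
    · exact ⟨x, fun ρ' hρ' => hρ'.left x le_rfl⟩
    · exact ⟨x, fun ρ' hρ' => hρ'.right x le_rfl⟩
  | one => exact ⟨0, fun ρ' _ => by rw [map_one, map_one]⟩
  | mul g k _ _ ihg ihk =>
    obtain ⟨M, hM⟩ := ihk x
    obtain ⟨N, hN⟩ := ihg (ρ k x)
    refine ⟨max M N, fun ρ' hρ' => ?_⟩
    rw [map_mul, map_mul, mul_apply, mul_apply, hM ρ' (hρ'.mono (le_max_left _ _)),
      hN ρ' (hρ'.mono (le_max_right _ _))]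
  | inv g _ ih =>
    obtain ⟨M, hM⟩ := ih ((ρ g)⁻¹ x)
    refine ⟨M, fun ρ' hρ' => ?_⟩
    rw [map_inv, map_inv, inv_eq_iff, hM ρ' hρ', apply_inv_self]

theorem exists_bound_of_finite (hab : IsHandle ι h a b) (ρ : G →* (ℝ ≃o ℝ)) {S : Set G}
    (hS : S.Finite) (x : ℝ) :
    ∃ M, ∀ ρ', AgreeBelow ι a b ρ ρ' M → ∀ s ∈ S, ρ' s x = ρ s x := by
  choose N hN using fun g => hab.exists_bound ρ g x
  obtain ⟨M, hM⟩ := (hS.image N).bddAbove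
  exact ⟨M, fun ρ' hρ' s hs => hN s ρ' (hρ'.mono (hM ⟨s, hs, rfl⟩))⟩

end IsHandle

/-- A bounded orbit gives rise to a global fixed point. -/
theorem exists_global_fixed (ρ : G →* (ℝ ≃o ℝ)) {c : ℝ} (hc : ∀ g, ρ g x₀ ≤ c) :
    ∃ s ≤ c, (∀ g, ρ g x₀ ≤ s) ∧ ∀ g, ρ g s = s := by
  have hbd : BddAbove (Set.range fun g => ρ g x₀) := ⟨c, by rintro _ ⟨g, rfl⟩; exact hc g⟩
  have hle : ∀ g, sSup (Set.range fun g => ρ g x₀) ≤ ρ g (sSup (Set.range fun g => ρ g x₀)) := by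
    refine fun g => csSup_le (Set.range_nonempty _) ?_
    rintro _ ⟨k, rfl⟩
    rw [← inv_le_iff, ← map_inv]
    refine le_csSup hbd ⟨g⁻¹ * k, ?_⟩
    simp only [map_mul]
    rfl
  refine ⟨_, csSup_le (Set.range_nonempty _) (by rintro _ ⟨g, rfl⟩; exact hc g),
    fun g => le_csSup hbd ⟨g, rfl⟩, fun g => le_antisymm ?_ (hle g)⟩
  rw [← le_inv_iff, ← map_inv]
  exact hle g⁻¹

/-- If the orbit of `x₀` is unbounded above, it remains unbounded by `M` when the action is changed
above `M` only. -/
theorem IsHandle.exists_gt_of_agreeBelow (hab : IsHandle ι h a b)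
    (hunb : ∀ M, ∃ g, M < ρ g x₀) {M : ℝ} (hM : AgreeBelow ι a b ρ ρ' M) :
    ∃ g, M < ρ' g x₀ := by
  by_contra! hc
  obtain ⟨s, hs, hxs, hfix⟩ := exists_global_fixed ρ' hc
  let stab : Subgroup G :=
    { carrier := {g | ρ g s = s}
      one_mem' := by simp
      mul_mem' := by
        intro f g hf hg
        simp only [Set.mem_ofPred_eq, map_mul, mul_apply] at *
        rw [hg, hf]
      inv_mem' := by
        intro f hf
        simp only [Set.mem_ofPred_eq, map_inv] at *
        rw [inv_eq_iff, hf] }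
  -- Since `s ≤ M`, the generators act on `s` alike in both actions, so `ρ` fixes `s` and cannot
  -- push `x₀ ≤ s` beyond it.
  have htop : stab = ⊤ := by
    rw [eq_top_iff, ← hab.closure_eq_top, Subgroup.closure_le]
    rintro _ (⟨k, rfl⟩ | rfl | rfl)
    · change ρ (ι k) s = s
      rw [← hM.base, hfix]
    · exact (hM.left s hs).symm.trans (hfix _)
    · exact (hM.right s hs).symm.trans (hfix _)
  obtain ⟨g, hg⟩ := hunb s
  have hgs : ρ g s = s := by
    have : g ∈ stab := htop ▸ Subgroup.mem_top g
    exact this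
  have hx₀ : x₀ ≤ s := by simpa using hxs 1
  exact absurd ((ρ g).le_iff_le.2 hx₀) (not_le.2 (hgs.symm ▸ hg))

/-- A rigid action for which `x₀` has a free orbit that is unbounded above. -/
structure IsRigidFree (ρ : G →* (ℝ ≃o ℝ)) (x₀ : ℝ) : Prop where
  rigid : LeftOrder.IsRigid ρ x₀
  exists_gt : ∀ M, ∃ g, M < ρ g x₀
  eq_one : ∀ g, ρ g x₀ = x₀ → g = 1

/-! ### Exclusion of each behaviour at infinity -/

namespace IsRigidFree

theorem apply_orbit_ne (hρ : IsRigidFree ρ x₀) {k : G} (hk : k ≠ 1) (g : G) :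
    ρ k (ρ g x₀) ≠ ρ g x₀ := by
  intro he
  refine hk ?_
  have : ρ (g⁻¹ * k * g) x₀ = x₀ := by
    rw [map_mul, map_mul, map_inv, mul_apply, mul_apply, he, inv_apply_self]
  have := hρ.eq_one _ this
  rwa [mul_assoc, inv_mul_eq_one, eq_comm, mul_eq_right] at this

theorem exists_rigid_bound (hρ : IsRigidFree ρ x₀) (hab : IsHandle ι h a b) :
    ∃ M, ∀ ρ', AgreeBelow ι a b ρ ρ' M → ∀ f k, ρ' f x₀ < ρ' k x₀ → ρ f x₀ < ρ k x₀ := by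
  obtain ⟨S, hS, hSr⟩ := hρ.rigid
  obtain ⟨M, hM⟩ := hab.exists_bound_of_finite ρ hS x₀
  exact ⟨M, fun ρ' hρ' => hSr ρ' (hM ρ' hρ')⟩

/-- Otherwise `a` could be changed to move everything above `z` up, and its powers would push an
orbit point past any other. Under `ρ` a fixed point of `a` separates suitable orbit points and
blocks these powers. -/
theorem exists_not_up (hρ : IsRigidFree ρ x₀) (hab : IsHandle ι h a b)
    (ha : FixedUnbounded (ρ a)) :
    ∃ Z, ∀ z, Z ≤ z → z ≤ ρ b z → ∃ x ∈ Set.Icc z (ρ b z), ρ a x ≤ x := by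
  obtain ⟨M, hM⟩ := hρ.exists_rigid_bound hab
  refine ⟨M, fun z hz hzb => ?_⟩
  by_contra! hup
  obtain ⟨A, B, hAB, hA, hB, hAup⟩ := exists_perturbation_up (hab.rel_map ρ) hzb hup
  obtain ⟨ρ', hagree, rfl, rfl⟩ := hab.exists_agreeBelow hAB hA hB
  obtain ⟨g, hg⟩ := hab.exists_gt_of_agreeBelow hρ.exists_gt hagree
  obtain ⟨p, hp, hap⟩ := ha (ρ g x₀ + 1)
  obtain ⟨k, hk⟩ := hρ.exists_gt p
  obtain ⟨n, hn⟩ := exists_lt_pow_apply (ρ' a) (m := ρ' g x₀) (c := ρ' k x₀)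
    (fun x hx => hAup x (hg.le.trans hx.1))
  rw [← map_pow_mul_apply] at hn
  have h1 := hM ρ' (hagree.mono hz) _ _ hn
  rw [map_pow_mul_apply] at h1
  exact absurd (h1.trans (pow_apply_lt (ρ a) hap (by linarith) n)) hk.not_gt

/-- Without a fixed point, `a` moves the whole interval up or down. The first is excluded by
`exists_not_up`, the second by the same lemma for the handle `flip`, on the image of the interval
under `a`. -/
theorem exists_fixed_between_of_le (hρ : IsRigidFree ρ x₀) (hab : IsHandle ι h a b)
    (ha : FixedUnbounded (ρ a)) :
    ∃ Z, ∀ z, Z ≤ z → z ≤ ρ b z → ∃ p ∈ Set.Icc z (ρ b z), ρ a p = p := by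
  obtain ⟨Z₁, h1⟩ := hρ.exists_not_up hab ha
  obtain ⟨Z₂, h2⟩ := hρ.exists_not_up hab.flip (by rw [map_inv]; exact ha.inv)
  refine ⟨max Z₁ ((ρ a)⁻¹ Z₂), fun z hz hzb => ?_⟩
  by_contra! hne
  rcases up_or_down_of_ne (ρ a) hne with hup | hdown
  · obtain ⟨x, hx, hx'⟩ := h1 z ((le_max_left _ _).trans hz) hzb
    exact absurd (hup x hx) hx'.not_gt
  · have hb : ρ (a * b * a⁻¹) (ρ a z) = ρ a (ρ b z) := by
      rw [map_mul, map_mul, map_inv, mul_apply, mul_apply, inv_apply_self]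
    obtain ⟨x, hx, hx'⟩ := h2 (ρ a z) ((inv_le_iff _).1 ((le_max_right _ _).trans hz))
      (by rw [hb]; exact (ρ a).le_iff_le.2 hzb)
    rw [hb] at hx
    rw [map_inv] at hx'
    have := hdown ((ρ a)⁻¹ x) ⟨(le_inv_iff _).2 hx.1, (inv_le_iff _).2 hx.2⟩
    rw [apply_inv_self] at this
    exact absurd this hx'.not_gt

/-- If `a` has arbitrarily large fixed points, then it has one between `z` and `b z`, for all large
`z`. -/
theorem exists_fixed_between (hρ : IsRigidFree ρ x₀) (hab : IsHandle ι h a b)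
    (ha : FixedUnbounded (ρ a)) :
    ∃ Z, ∀ z, Z ≤ z → ∃ p ∈ Set.uIcc z (ρ b z), ρ a p = p := by
  obtain ⟨Z₁, h1⟩ := hρ.exists_fixed_between_of_le hab ha
  -- This handle is `(b a b⁻¹, b⁻¹)`. Used at the point `b (b z)`, it turns the case `b z ≤ z` into
  -- the previous one, up to translation by `b`.
  obtain ⟨Z₂, h2⟩ := hρ.exists_fixed_between_of_le hab.swap.flip.swap
    (by rw [map_mul, map_mul, map_inv]; exact ha.conj _)
  refine ⟨max Z₁ ((ρ b)⁻¹ ((ρ b)⁻¹ Z₂)), fun z hz => ?_⟩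
  rcases le_total z (ρ b z) with hzb | hzb
  · rw [Set.uIcc_of_le hzb]
    exact h1 z ((le_max_left _ _).trans hz) hzb
  · rw [Set.uIcc_of_ge hzb]
    obtain ⟨p, hp, hp'⟩ := h2 (ρ b (ρ b z))
      (by rw [← inv_le_iff, ← inv_le_iff]; exact (le_max_right _ _).trans hz)
      (by rw [map_inv, inv_apply_self]; exact (ρ b).le_iff_le.2 hzb)
    rw [map_inv, inv_apply_self] at hp
    rw [map_mul, map_mul, map_inv, mul_apply, mul_apply] at hp'
    have h3 : (ρ b)⁻¹ p ≤ z := (inv_le_iff _).2 hp.2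
    exact ⟨(ρ b)⁻¹ p, ⟨(le_inv_iff _).2 hp.1, h3⟩, ((inv_eq_iff (ρ b)).2 hp'.symm).symm⟩

theorem left_ne_one (hab : IsHandle ι h a b) (hh : ι h ≠ 1) : a ≠ 1 := by
  rintro rfl
  refine hh ?_
  have := hab.rel
  simpa using this

/-- For a large orbit point `z`, some `p` between `z` and `b z` is fixed by `a`. A fixed point of
`b` lies between `p` and `a p = p`, so `b` fixes `p`. By monotonicity `p = z`, but `a ≠ 1` fixes no
orbit point. -/
theorem false_of_fixedUnbounded (hρ : IsRigidFree ρ x₀) (hab : IsHandle ι h a b) (hh : ι h ≠ 1)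
    (ha : FixedUnbounded (ρ a)) (hb : FixedUnbounded (ρ b)) : False := by
  obtain ⟨Z₁, h1⟩ := hρ.exists_fixed_between hab.swap hb
  obtain ⟨Z₂, h2⟩ := hρ.exists_fixed_between hab ha
  obtain ⟨g, hg⟩ := hρ.exists_gt (max (max Z₁ ((ρ b)⁻¹ Z₁)) Z₂)
  have hne := hρ.apply_orbit_ne (left_ne_one hab hh) g
  set z := ρ g x₀
  obtain ⟨⟨hz1, hz2⟩, hz3⟩ : (Z₁ < z ∧ (ρ b)⁻¹ Z₁ < z) ∧ Z₂ < z := by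
    simpa only [max_lt_iff] using hg
  obtain ⟨p, hp, hap⟩ := h2 z hz3.le
  have hpZ : Z₁ ≤ p := (le_inf hz1.le ((inv_lt_iff _).1 hz2).le).trans hp.1
  have hbp : ρ b p = p := by
    obtain ⟨q, hq, hbq⟩ := h1 p hpZ
    rw [hap, Set.uIcc_self, Set.mem_singleton_iff] at hq
    rwa [hq] at hbq
  have hpz : p = z := by
    rcases Set.mem_uIcc.1 hp with hp | hp
    · exact le_antisymm ((ρ b).le_iff_le.1 (hbp.le.trans hp.2)) hp.1
    · exact le_antisymm hp.2 ((ρ b).le_iff_le.1 (hp.1.trans hbp.ge))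
  exact hne (hpz ▸ hap)

/-- A fixed point `p` of `a` between `z` and `b z` gives `z ≤ p ≤ a (b z)`, and one inequality is
strict. -/
theorem eventuallyUp_mul (hρ : IsRigidFree ρ x₀) (hab : IsHandle ι h a b)
    (ha : FixedUnbounded (ρ a)) (hb : EventuallyUp (ρ b)) : EventuallyUp (ρ (a * b)) := by
  obtain ⟨Z, h1⟩ := hρ.exists_fixed_between hab ha
  obtain ⟨u, hu⟩ := hb
  refine ⟨max Z u, fun z hz => ?_⟩
  have hzb := hu z ((le_max_right _ _).trans hz)
  obtain ⟨p, hp, hap⟩ := h1 z ((le_max_left _ _).trans hz)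
  rw [Set.uIcc_of_le hzb.le] at hp
  rw [map_mul, mul_apply]
  rcases hp.2.lt_or_eq with hlt | rfl
  · exact hp.1.trans_lt (hap.symm.trans_lt ((ρ a).lt_iff_lt.2 hlt))
  · rwa [hap]

theorem eventuallyDown_mul (hρ : IsRigidFree ρ x₀) (hab : IsHandle ι h a b)
    (ha : FixedUnbounded (ρ a)) (hb : EventuallyDown (ρ b)) : EventuallyDown (ρ (a * b)) := by
  obtain ⟨Z, h1⟩ := hρ.exists_fixed_between hab ha
  obtain ⟨u, hu⟩ := hb
  refine ⟨max Z u, fun z hz => ?_⟩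
  have hzb := hu z ((le_max_right _ _).trans hz)
  obtain ⟨p, hp, hap⟩ := h1 z ((le_max_left _ _).trans hz)
  rw [Set.uIcc_of_ge hzb.le] at hp
  rw [map_mul, mul_apply]
  rcases hp.1.lt_or_eq with hlt | rfl
  · exact (((ρ a).lt_iff_lt.2 hlt).trans_eq hap).trans_le hp.2
  · rwa [hap]

/-- After the perturbation, a fixed point `y` of `a` traps the points `a ^ n g₀ x₀`, while the orbit
still passes `y`. Under `ρ` these points overtake the whole orbit, so the order has changed. -/
theorem false_of_eventuallyUp_of_exists_lt (hρ : IsRigidFree ρ x₀) (hab : IsHandle ι h a b)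
    (ha : EventuallyUp (ρ a)) (hb : EventuallyUp (ρ b)) (hC : ∀ u, ∃ y ≥ u, ρ (ι h) y < y) :
    False := by
  obtain ⟨M, hM⟩ := hρ.exists_rigid_bound hab
  obtain ⟨ua, hua⟩ := ha
  obtain ⟨ub, hub⟩ := hb
  obtain ⟨g₀, hg₀⟩ := hρ.exists_gt ua
  obtain ⟨N, hN⟩ := hab.exists_bound ρ g₀ x₀
  -- Above `M` changes preserve the order, above `N` they preserve the position of `g₀ x₀`; the
  -- other two bounds put `m` where `b` and `a` move points up.
  obtain ⟨m, hm⟩ : ∃ m, M ≤ m ∧ N ≤ m ∧ ub ≤ m ∧ ρ g₀ x₀ ≤ m :=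
    ⟨max (max M N) (max ub (ρ g₀ x₀)), by simp⟩
  obtain ⟨hMm, hNm, hubm, hgm⟩ := hm
  have huam : ua ≤ m := hg₀.le.trans hgm
  have hmb := hub m hubm
  have hup : ∀ x, m ≤ x → x < ρ a x := fun x hx => hua x (huam.trans hx)
  obtain ⟨y, hy, hCy⟩ := hC (2 * ρ a (ρ b m) - ρ b m)
  obtain ⟨A, B, hAB, hA, hB, hAy, hBy, hAlt⟩ :=
    exists_perturbation_fixed (hab.rel_map ρ) hmb.le hup hy hCy
  have hmy : m < y := by
    have := hup _ hmb.le
    linarith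
  obtain ⟨ρ', hagree, rfl, rfl⟩ := hab.exists_agreeBelow hAB hA hB
  -- Otherwise there would be a global fixed point in `[m, y]`; but `a` moves every point of `[m,
  -- y)` and `b` moves `y`.
  obtain ⟨g, hg⟩ : ∃ g, y < ρ' g x₀ := by
    by_contra! hc
    obtain ⟨s, hsy, hs, hfix⟩ := exists_global_fixed ρ' hc
    obtain ⟨k, hk⟩ := hab.exists_gt_of_agreeBelow hρ.exists_gt hagree
    rcases hsy.lt_or_eq with hsy | rfl
    · exact (hAlt s ⟨hk.le.trans (hs k), hsy⟩).ne' (hfix a)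
    · exact hBy.ne' (hfix b)
  have hg₀' : ρ' g₀ x₀ = ρ g₀ x₀ := hN ρ' (hagree.mono hNm)
  obtain ⟨n, hn⟩ := exists_lt_pow_apply (ρ a) (m := ρ g₀ x₀) (c := ρ g x₀)
    (fun x hx => hua x (hg₀.le.trans hx.1))
  have h1 : ρ' (a ^ n * g₀) x₀ < ρ' g x₀ := by
    rw [map_pow_mul_apply, hg₀']
    exact (pow_apply_lt _ hAy (hgm.trans_lt hmy) n).trans hg
  have h2 := hM ρ' (hagree.mono hMm) _ _ h1
  rw [map_pow_mul_apply] at h2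
  exact hn.not_gt h2

/-- Exchanging `a` and `b` inverts `C`. If `C` moves no large point down, `C⁻¹` moves all large
orbit points down, since `C` fixes none of them. -/
theorem false_of_eventuallyUp (hρ : IsRigidFree ρ x₀) (hab : IsHandle ι h a b) (hh : ι h ≠ 1)
    (ha : EventuallyUp (ρ a)) (hb : EventuallyUp (ρ b)) : False := by
  by_cases hC : ∀ u, ∃ y ≥ u, ρ (ι h) y < y
  · exact hρ.false_of_eventuallyUp_of_exists_lt hab ha hb hC
  · push Not at hC
    obtain ⟨u, hu⟩ := hC
    refine hρ.false_of_eventuallyUp_of_exists_lt hab.swap hb ha fun v => ?_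
    obtain ⟨g, hg⟩ := hρ.exists_gt (max u v)
    refine ⟨ρ g x₀, ((le_max_right _ _).trans_lt hg).le, ?_⟩
    rw [map_inv, map_inv, inv_lt_iff]
    exact lt_of_le_of_ne (hu _ ((le_max_left _ _).trans_lt hg).le)
      (hρ.apply_orbit_ne hh g).symm

theorem false_of_eventuallyDown_of_eventuallyUp (hρ : IsRigidFree ρ x₀)
    (hab : IsHandle ι h a b) (hh : ι h ≠ 1)
    (ha : EventuallyDown (ρ a)) (hb : EventuallyUp (ρ b)) : False :=
  hρ.false_of_eventuallyUp hab.flip (by rwa [map_inv, inv_ne_one])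
    (by rw [map_inv]; exact ha.inv) (by rw [map_mul, map_mul, map_inv]; exact hb.conj _)

theorem false_of_eventuallyDown (hρ : IsRigidFree ρ x₀) (hab : IsHandle ι h a b) (hh : ι h ≠ 1)
    (ha : EventuallyDown (ρ a)) (hb : EventuallyDown (ρ b)) : False :=
  hρ.false_of_eventuallyDown_of_eventuallyUp hab.flip.swap (by simpa using hh)
    (by rw [map_mul, map_mul, map_inv]; exact hb.conj _) (by rw [map_inv]; exact ha.inv)

/-- Unless `b` also has arbitrarily large fixed points, `a b` moves large points in the same
direction as `b`, so `(a b, b)` falls under a case already excluded. -/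
theorem false_of_fixedUnbounded_left (hρ : IsRigidFree ρ x₀) (hab : IsHandle ι h a b)
    (hh : ι h ≠ 1) (ha : FixedUnbounded (ρ a)) : False := by
  rcases trichotomy_infinity (ρ b) with hb | hb | hb
  · exact hρ.false_of_fixedUnbounded hab hh ha hb
  · exact hρ.false_of_eventuallyUp hab.mul_left hh (hρ.eventuallyUp_mul hab ha hb) hb
  · exact hρ.false_of_eventuallyDown hab.mul_left hh (hρ.eventuallyDown_mul hab ha hb) hb

/-- A group with a handle has no rigid action on the line. -/
theorem false_of_isHandle (hρ : IsRigidFree ρ x₀) (hab : IsHandle ι h a b) (hh : ι h ≠ 1) :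
    False := by
  have hh' : ι h⁻¹ ≠ 1 := by rwa [map_inv, inv_ne_one]
  rcases trichotomy_infinity (ρ a) with ha | ha | ha
  · exact hρ.false_of_fixedUnbounded_left hab hh ha
  all_goals rcases trichotomy_infinity (ρ b) with hb | hb | hb
  · exact hρ.false_of_fixedUnbounded_left hab.swap hh' hb
  · exact hρ.false_of_eventuallyUp hab hh ha hb
  · exact hρ.false_of_eventuallyDown_of_eventuallyUp hab.swap hh' hb ha
  · exact hρ.false_of_fixedUnbounded_left hab.swap hh' hb
  · exact hρ.false_of_eventuallyDown_of_eventuallyUp hab hh ha hb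
  · exact hρ.false_of_eventuallyDown hab hh ha hb

end IsRigidFree

end Handle

theorem mainTheorem7 {G : Type v} [Group G] [Countable G] (hG : IsLeftOrderable G)
    {H : Type u} [Group H] (h : H) (hh : h ≠ 1)
    (e : G ≃* HandleAmalgam H h) :
    ∀ o : LeftOrder G, ¬ IsOpen ({o} : Set (LeftOrder G)) := by
  intro o ho
  have hne : e.symm (HandleAmalgam.ofBase H h h) ≠ 1 := by
    rw [Ne, EmbeddingLike.map_eq_one_iff]
    exact HandleAmalgam.ofBase_ne_one hh
  have : Nontrivial G := ⟨_, _, hne⟩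
  obtain ⟨ρ, x₀, hρ⟩ := o.exists_isRealization
  refine IsRigidFree.false_of_isHandle (ρ := ρ) (x₀ := x₀) ⟨hρ.isRigid ho, hρ.exists_gt, ?_⟩
    (HandleAmalgam.isHandle e) hne
  intro g hg
  by_contra hg1
  rcases o.le_total 1 g with h1 | h1
  · have := (hρ.lt_iff 1 g).2 ⟨h1, Ne.symm hg1⟩
    simp [hg] at this
  · have := (hρ.lt_iff g 1).2 ⟨h1, hg1⟩
    simp [hg] at this
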